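/- Let $X$ be a real Banach space that is smooth (i.e. $\lim_{t\to0}(\|x+ty\|-\|x\|)/t$ exists for all unit vectors $x,y$), strictly convex and reflexive, and let $J:X\to X^*$ be its normalized duality mapping, $Jx=\{x^*\in X^*:\langle x,x^*\rangle=\|x\|^2=\|x^*\|^2\}$, which is single-valued because $X$ is smooth. Let $\alpha\in\mathbb R$ and let $A:X\rightrightarrows X^*$ be a set-valued operator that is $\alpha$-monotone, i.e. $\langle x-y,u-v\rangle\ge\alpha\langle x-y,Jx-Jy\rangle$ for all $(x,u),(y,v)$ in the graph of $A$. Let $\gamma>0$ be such that $1+\gamma\alpha>0$, and let $J_{\gamma A}=(J+\gamma A)^{-1}\circ J:X\rightrightarrows X$ be the resolvent of $\gamma A$. Then: (i) $J_{\gamma A}$ is single-valued, i.e. $J_{\gamma A}x$ has at most one element for every $x\in X$; (ii) $\operatorname{dom}J_{\gamma A}=\{x\in X: J_{\gamma A}x\neq\emptyset\}$ is all of $X$ if and only if $A$ is maximally $\alpha$-monotone, i.e. there is no $\alpha$-monotone operator $B:X\rightrightarrows X^*$ whose graph properly contains the graph of $A$. -/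

import Mathlib

open Set Filter Topology
open scoped Pointwise

/-- A real normed space is smooth if its norm is Gateaux differentiable on the unit sphere. -/
def IsSmoothSpace (X : Type*) [NormedAddCommGroup X] [NormedSpace ℝ X] : Prop :=
  ∀ x y : X, ‖x‖ = 1 → ‖y‖ = 1 →
    ∃ l : ℝ, Tendsto (fun t : ℝ => (‖x + t • y‖ - ‖x‖) / t) (𝓝[≠] 0) (𝓝 l)

/-- A real normed space is reflexive if its canonical map to the bidual is onto. -/
def IsReflexiveSpace (X : Type*) [NormedAddCommGroup X] [NormedSpace ℝ X] : Prop :=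
  Function.Surjective (NormedSpace.inclusionInDoubleDual ℝ X)

/-- Set-valued operators from `Y` to `Z`. Sums and scalar multiples are the pointwise ones of
Minkowski sets: `(S + T) x = {u + v | u ∈ S x, v ∈ T x}` and `(c • T) x = {c • u | u ∈ T x}`. -/
abbrev SetValuedMap (Y Z : Type*) := Y → Set Z

namespace SetValuedMap

variable {Y Z W : Type*}

/-- The graph. -/
def gra (T : SetValuedMap Y Z) : Set (Y × Z) := {p | p.2 ∈ T p.1}

/-- The domain. -/
def dom (T : SetValuedMap Y Z) : Set Y := {x | (T x).Nonempty}

/-- The inverse operator. -/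
def inverse (T : SetValuedMap Y Z) : SetValuedMap Z Y := fun u => {x | u ∈ T x}

/-- The composition `S ∘ T`. -/
def comp (S : SetValuedMap Z W) (T : SetValuedMap Y Z) : SetValuedMap Y W :=
  fun x => {w | ∃ z ∈ T x, w ∈ S z}

/-- Single-valuedness: every value has at most one element (values may be empty). -/
def IsSingleValued (T : SetValuedMap Y Z) : Prop := ∀ x, (T x).Subsingleton

end SetValuedMap

section Duality

variable {X : Type*} [NormedAddCommGroup X] [NormedSpace ℝ X]

/-- The normalized duality mapping `J`. -/
def dualityMap (X : Type*) [NormedAddCommGroup X] [NormedSpace ℝ X] :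
    SetValuedMap X (StrongDual ℝ X) :=
  fun x => {u | u x = ‖x‖ ^ 2 ∧ ‖u‖ ^ 2 = ‖x‖ ^ 2}

/-- The resolvent `(J + A)⁻¹ ∘ J`. -/
def dualityResolvent (A : SetValuedMap X (StrongDual ℝ X)) : SetValuedMap X X :=
  SetValuedMap.comp (SetValuedMap.inverse (dualityMap X + A)) (dualityMap X)

/-- `α`-monotonicity relative to the duality mapping of a smooth space. In such a space `J x` and
`J y` are singletons (see `IsSmoothSpace.existsUnique_mem_dualityMap`), so `j` and `k` below are
just `J x` and `J y`. -/
def IsAlphaMonotone (α : ℝ) (A : SetValuedMap X (StrongDual ℝ X)) : Prop :=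
  ∀ x u y v, (x, u) ∈ A.gra → (y, v) ∈ A.gra →
    ∀ j ∈ dualityMap X x, ∀ k ∈ dualityMap X y, α * (j - k) (x - y) ≤ (u - v) (x - y)

/-- Maximal `α`-monotonicity. -/
def IsMaximallyAlphaMonotone (α : ℝ) (A : SetValuedMap X (StrongDual ℝ X)) : Prop :=
  IsAlphaMonotone α A ∧
    ¬ ∃ B : SetValuedMap X (StrongDual ℝ X), IsAlphaMonotone α B ∧ A.gra ⊂ B.gra

/-- In a smooth space the duality mapping takes exactly one value at each point. -/
theorem IsSmoothSpace.existsUnique_mem_dualityMap (hX : IsSmoothSpace X) (x : X) :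
    ∃! u, u ∈ dualityMap X x := by
  have key : ∀ (u : StrongDual ℝ X) (e y : X) (l : ℝ), ‖e‖ = 1 → ‖u‖ = 1 → u e = 1 →
      Tendsto (fun t : ℝ => (‖e + t • y‖ - ‖e‖) / t) (𝓝[≠] 0) (𝓝 l) → u y = l := by
    intro u e y l he hu hue hl
    have hb : ∀ t : ℝ, t * u y ≤ ‖e + t • y‖ - ‖e‖ := by
      intro t
      have h1 : u (e + t • y) ≤ ‖e + t • y‖ := by
        have := u.le_opNorm (e + t • y)
        rw [hu, one_mul] at this
        exact (le_abs_self _).trans this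
      simp only [map_add, map_smul, smul_eq_mul, hue] at h1
      linarith
    apply le_antisymm
    · refine ge_of_tendsto (hl.mono_left (nhdsWithin_mono 0
        (fun t (ht : t ∈ Ioi (0 : ℝ)) => ne_of_gt ht))) ?_
      filter_upwards [self_mem_nhdsWithin] with t ht
      rw [le_div_iff₀ ht]
      linarith [hb t]
    · refine le_of_tendsto (hl.mono_left (nhdsWithin_mono 0
        (fun t (ht : t ∈ Iio (0 : ℝ)) => ne_of_lt ht))) ?_
      filter_upwards [self_mem_nhdsWithin] with t ht
      rw [div_le_iff_of_neg ht]
      linarith [hb t]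
  by_cases hx : x = 0
  · subst hx
    refine ⟨0, by simp [dualityMap], ?_⟩
    rintro u ⟨-, hu⟩
    simpa using hu
  have hx0 : 0 < ‖x‖ := norm_pos_iff.2 hx
  obtain ⟨g, hg, hgx⟩ := exists_dual_vector ℝ x hx0.ne'
  refine ⟨‖x‖ • g, ⟨?_, ?_⟩, ?_⟩
  · simp [hgx, sq]
  · simp [norm_smul, hg]
  · rintro u ⟨hux, hu⟩
    have hun : ‖u‖ = ‖x‖ := (sq_eq_sq₀ (norm_nonneg _) (norm_nonneg _)).1 hu
    have he : ‖‖x‖⁻¹ • x‖ = 1 := by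
      rw [norm_smul, norm_inv, norm_norm, inv_mul_cancel₀ hx0.ne']
    have hge : g (‖x‖⁻¹ • x) = 1 := by
      simp [hgx, hx0.ne']
    have hue : (‖x‖⁻¹ • u) (‖x‖⁻¹ • x) = 1 := by
      simp only [map_smul, smul_apply, smul_eq_mul, hux]
      field_simp
    have hu1 : ‖‖x‖⁻¹ • u‖ = 1 := by
      rw [norm_smul, norm_inv, norm_norm, hun, inv_mul_cancel₀ hx0.ne']
    have hunit : ∀ y : X, ‖y‖ = 1 → (‖x‖⁻¹ • u) y = g y := by
      intro y hy
      obtain ⟨l, hl⟩ := hX _ y he hy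
      rw [key _ _ _ _ he hu1 hue hl, key _ _ _ _ he hg hge hl]
    ext y
    by_cases hy : y = 0
    · simp [hy]
    have hy0 : ‖y‖ ≠ 0 := norm_ne_zero_iff.2 hy
    have h := hunit (‖y‖⁻¹ • y) (by rw [norm_smul, norm_inv, norm_norm, inv_mul_cancel₀ hy0])
    simp only [map_smul, smul_apply, smul_eq_mul] at h ⊢
    have hx' := hx0.ne'
    field_simp at h
    linarith

end Duality

/-!
An operator `A` is `α`-monotone exactly when `A - α J` is monotone, and
`J + γ A = (1 + γ α) J + γ (A - α J)`. Single-valuedness of the resolvent, and maximality of `A`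
when the resolvent has full domain, therefore follow from strict monotonicity of `J`, which is
strict convexity of the norm (`eq_of_mem_dualityMap_of_apply_sub_nonpos`), together with
surjectivity of `J`, which is reflexivity (`IsReflexiveSpace.exists_mem_dualityMap`).

The remaining implication is the theorem of Minty, Browder and Rockafellar: a maximal monotone
`G ⊆ X × X*` contains a point `(y, v)` with `-v ∈ J y`
(`IsReflexiveSpace.exists_mem_neg_mem_dualityMap`). It is proved by one application of the
Hahn–Banach theorem in `(X × X*) × ℝ`. Monotonicity of `G` says that the convex hull of the points
`((x, u), u x)` with `(x, u) ∈ G` lies above the graph of the pairing `u x`, hence above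
`-‖x‖² / 2 - ‖u‖² / 2`. A hyperplane that separates the hull from the open convex region strictly
below this concave function is not vertical, and by reflexivity its slope is a point `(U, Y)` of
`X* × X`. The two inequalities say that `(-Y, -U)` is monotonically related to `G`, hence belongs to
`G` by maximality, and that equality holds in `-U Y ≤ ‖U‖² / 2 + ‖Y‖² / 2`, which is to say
`-U ∈ J Y`, or `U ∈ J (-Y)`.
-/

/-! ### The normalized duality mapping -/

section DualityMap

variable {X : Type*} [NormedAddCommGroup X] [NormedSpace ℝ X]

theorem norm_eq_of_mem_dualityMap {x : X} {u : StrongDual ℝ X} (hu : u ∈ dualityMap X x) :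
    ‖u‖ = ‖x‖ :=
  (sq_eq_sq₀ (norm_nonneg _) (norm_nonneg _)).1 hu.2

theorem exists_mem_dualityMap (x : X) : ∃ u, u ∈ dualityMap X x := by
  rcases eq_or_ne x 0 with rfl | hx
  · exact ⟨0, by simp [dualityMap]⟩
  · obtain ⟨g, hg, hgx⟩ := exists_dual_vector ℝ x (norm_ne_zero_iff.2 hx)
    exact ⟨‖x‖ • g, by simp [hgx, sq], by simp [norm_smul, hg]⟩

theorem neg_mem_dualityMap_neg {x : X} {u : StrongDual ℝ X} (hu : u ∈ dualityMap X x) :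
    -u ∈ dualityMap X (-x) :=
  ⟨by simpa using hu.1, by simpa using hu.2⟩

theorem neg_apply_le (x : X) (u : StrongDual ℝ X) : -(u x) ≤ ‖x‖ ^ 2 / 2 + ‖u‖ ^ 2 / 2 := by
  have h : |u x| ≤ ‖u‖ * ‖x‖ := u.le_opNorm x
  nlinarith [neg_le_abs (u x), sq_nonneg (‖u‖ - ‖x‖)]

/-- The equality case of Young's inequality `-u x ≤ ‖x‖² / 2 + ‖u‖² / 2` characterizes
`-u ∈ J x`. -/
theorem neg_mem_dualityMap_of_le {x : X} {u : StrongDual ℝ X}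
    (h : ‖x‖ ^ 2 / 2 + ‖u‖ ^ 2 / 2 ≤ -(u x)) : -u ∈ dualityMap X x := by
  have hb : |u x| ≤ ‖u‖ * ‖x‖ := u.le_opNorm x
  have hn : ‖u‖ = ‖x‖ := by
    have : (‖u‖ - ‖x‖) ^ 2 ≤ 0 := by nlinarith [neg_le_abs (u x)]
    nlinarith [pow_eq_zero_iff two_ne_zero |>.1 (le_antisymm this (sq_nonneg _))]
  refine ⟨?_, by rw [norm_neg, hn]⟩
  rw [hn] at h hb
  change -(u x) = _
  nlinarith [neg_le_abs (u x)]

/-- In a reflexive space the duality mapping is onto: a functional of the bidual that norms `u` is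
evaluation at a point. -/
theorem IsReflexiveSpace.exists_mem_dualityMap (h : IsReflexiveSpace X) (u : StrongDual ℝ X) :
    ∃ x, u ∈ dualityMap X x := by
  obtain ⟨φ, hφu, hφn⟩ := _root_.exists_mem_dualityMap u
  obtain ⟨x, rfl⟩ := h φ
  have hn : ‖NormedSpace.inclusionInDoubleDual ℝ X x‖ = ‖x‖ :=
    (NormedSpace.inclusionInDoubleDualLi ℝ (E := X)).norm_map x
  rw [hn] at hφn
  rw [NormedSpace.dual_def] at hφu
  exact ⟨x, hφu.trans hφn.symm, hφn.symm⟩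

/-- In a strictly convex space the duality mapping is strictly monotone. -/
theorem eq_of_mem_dualityMap_of_apply_sub_nonpos [StrictConvexSpace ℝ X] {x y : X}
    {j k : StrongDual ℝ X} (hj : j ∈ dualityMap X x) (hk : k ∈ dualityMap X y)
    (h : (j - k) (x - y) ≤ 0) : x = y := by
  have h1 : |j y| ≤ ‖j‖ * ‖y‖ := j.le_opNorm y
  have h2 : |k x| ≤ ‖k‖ * ‖x‖ := k.le_opNorm x
  have h3 : |j (x + y)| ≤ ‖j‖ * ‖x + y‖ := j.le_opNorm (x + y)
  rw [norm_eq_of_mem_dualityMap hj] at h1 h3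
  rw [norm_eq_of_mem_dualityMap hk] at h2
  simp only [sub_apply, map_sub, hj.1, hk.1] at h
  have hn : ‖x‖ = ‖y‖ := by
    have : (‖x‖ - ‖y‖) ^ 2 ≤ 0 := by nlinarith [le_abs_self (j y), le_abs_self (k x)]
    nlinarith [pow_eq_zero_iff two_ne_zero |>.1 (le_antisymm this (sq_nonneg _))]
  rw [← hn] at h1 h2 h
  have hjy : j y = ‖x‖ ^ 2 := by nlinarith [le_abs_self (j y), le_abs_self (k x)]
  rw [map_add, hj.1, hjy] at h3
  rcases (norm_nonneg x).eq_or_lt with h0 | h0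
  · rw [norm_eq_zero.1 h0.symm, norm_eq_zero.1 (hn.symm.trans h0.symm)]
  · refine eq_of_norm_eq_of_norm_add_eq hn (le_antisymm (norm_add_le x y) ?_)
    rw [← hn]
    refine le_of_mul_le_mul_left ?_ h0
    nlinarith [le_abs_self (‖x‖ ^ 2 + ‖x‖ ^ 2)]

end DualityMap

/-! ### Maximal monotone sets in reflexive spaces -/

section Monotone

variable {X : Type*} [NormedAddCommGroup X] [NormedSpace ℝ X]

/-- A point in the convex hull of the lifted graph `{((x, u), u x)}` of a monotone set lies above
the graph of the pairing. -/
theorem apply_le_of_mem_convexHull_lift {G : Set (X × StrongDual ℝ X)}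
    (hG : ∀ p ∈ G, ∀ q ∈ G, 0 ≤ (p.2 - q.2) (p.1 - q.1))
    {c : (X × StrongDual ℝ X) × ℝ}
    (hc : c ∈ convexHull ℝ ((fun p : X × StrongDual ℝ X => (p, p.2 p.1)) '' G)) :
    c.1.2 c.1.1 ≤ c.2 := by
  -- For points `a`, `b` of `(X × X*) × ℝ` the inequality below is affine in `a` and in `b`; on
  -- pairs of lifted points it is monotonicity, so it extends to the hull one argument at a time.
  -- For `a = b = c` it is twice the claim.
  have step : ∀ a : (X × StrongDual ℝ X) × ℝ,
      Convex ℝ {b : (X × StrongDual ℝ X) × ℝ |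
        a.1.2 b.1.1 + b.1.2 a.1.1 ≤ a.2 + b.2} := by
    intro a b hb c hc s t hs ht hst
    simp only [mem_ofPred_eq, Prod.fst_add, Prod.snd_add, Prod.smul_fst, Prod.smul_snd, map_add,
      map_smul, add_apply, smul_apply, smul_eq_mul] at hb hc ⊢
    have h1 := mul_le_mul_of_nonneg_left hb hs
    have h2 := mul_le_mul_of_nonneg_left hc ht
    have h3 : a.2 = s * a.2 + t * a.2 := by rw [← add_mul, hst, one_mul]
    linarith
  have h1 : ∀ p ∈ G, c.1.2 p.1 + p.2 c.1.1 ≤ c.2 + p.2 p.1 := by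
    intro p hp
    have := convexHull_min (t := {b : (X × StrongDual ℝ X) × ℝ |
        p.2 b.1.1 + b.1.2 p.1 ≤ p.2 p.1 + b.2}) ?_ (step (p, p.2 p.1)) hc
    · simp only [mem_ofPred_eq] at this
      linarith
    · rintro _ ⟨q, hq, rfl⟩
      have := hG p hp q hq
      simp only [sub_apply, map_sub] at this
      simp only [mem_ofPred_eq]
      linarith
  have h2 := convexHull_min (t := {b : (X × StrongDual ℝ X) × ℝ |
        c.1.2 b.1.1 + b.1.2 c.1.1 ≤ c.2 + b.2}) ?_ (step c) hc
  · simp only [mem_ofPred_eq] at h2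
    linarith
  · rintro _ ⟨q, hq, rfl⟩
    exact h1 q hq

theorem convex_setOf_lt_neg_norm_sq :
    Convex ℝ {d : (X × StrongDual ℝ X) × ℝ | ‖d.1.1‖ ^ 2 + ‖d.1.2‖ ^ 2 + 2 * d.2 < 0} := by
  have h1 : ConvexOn ℝ univ fun d : (X × StrongDual ℝ X) × ℝ => ‖d.1.1‖ ^ 2 :=
    ((convexOn_univ_norm (E := X)).pow (fun _ _ => norm_nonneg _) 2).comp_linearMap
      (LinearMap.fst ℝ X (StrongDual ℝ X) ∘ₗ LinearMap.fst ℝ (X × StrongDual ℝ X) ℝ)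
  have h2 : ConvexOn ℝ univ fun d : (X × StrongDual ℝ X) × ℝ => ‖d.1.2‖ ^ 2 :=
    ((convexOn_univ_norm (E := StrongDual ℝ X)).pow (fun _ _ => norm_nonneg _) 2).comp_linearMap
      (LinearMap.snd ℝ X (StrongDual ℝ X) ∘ₗ LinearMap.fst ℝ (X × StrongDual ℝ X) ℝ)
  have h3 : ConvexOn ℝ univ fun d : (X × StrongDual ℝ X) × ℝ => 2 * d.2 :=
    ((2 : ℝ) • LinearMap.snd ℝ (X × StrongDual ℝ X) ℝ).convexOn convex_univ
  simpa using ((h1.add h2).add h3).convex_lt 0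

/-- The non-vertical hyperplane that separates the lifted graph of a monotone set from the region
below `-‖x‖² / 2 - ‖u‖² / 2`. Its slope in the `X*` direction is a point of `X` by
reflexivity. -/
theorem IsReflexiveSpace.exists_separation (h : IsReflexiveSpace X)
    {G : Set (X × StrongDual ℝ X)} (hne : G.Nonempty)
    (hG : ∀ p ∈ G, ∀ q ∈ G, 0 ≤ (p.2 - q.2) (p.1 - q.1)) :
    ∃ (U : StrongDual ℝ X) (Y : X) (s : ℝ),
      (∀ (x : X) (u : StrongDual ℝ X), U x + u Y - ‖x‖ ^ 2 / 2 - ‖u‖ ^ 2 / 2 ≤ s) ∧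
      ∀ p ∈ G, s ≤ U p.1 + p.2 Y + p.2 p.1 := by
  obtain ⟨f, s, hD, hC⟩ := geometric_hahn_banach_open
    (s := {d : (X × StrongDual ℝ X) × ℝ | ‖d.1.1‖ ^ 2 + ‖d.1.2‖ ^ 2 + 2 * d.2 < 0})
    (t := convexHull ℝ ((fun p : X × StrongDual ℝ X => (p, p.2 p.1)) '' G))
    convex_setOf_lt_neg_norm_sq
    (isOpen_lt (by fun_prop) continuous_const) (convex_convexHull ℝ _) (by
      rw [Set.disjoint_left]
      intro c hc hc'
      have h1 := apply_le_of_mem_convexHull_lift hG hc'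
      have h2 := neg_apply_le c.1.1 c.1.2
      simp only [mem_ofPred_eq] at hc
      linarith)
  -- Split `f` into its slopes `V`, `φ` and `τ` along `X`, `X*` and `ℝ`.
  set V : StrongDual ℝ X := f ∘L .inl ℝ (X × StrongDual ℝ X) ℝ ∘L .inl ℝ X (StrongDual ℝ X)
    with hV
  set φ : StrongDual ℝ (StrongDual ℝ X) :=
    f ∘L .inl ℝ (X × StrongDual ℝ X) ℝ ∘L .inr ℝ X (StrongDual ℝ X) with hφ
  set τ : ℝ := f ((0, 0), 1) with hτ
  have hf : ∀ x u t, f ((x, u), t) = V x + φ u + t * τ := by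
    intro x u t
    have : (((x, u), t) : (X × StrongDual ℝ X) × ℝ)
        = ((x, 0), 0) + ((0, u), 0) + t • ((0, 0), 1) := by ext <;> simp
    rw [this, map_add, map_add, map_smul]
    simp [hV, hφ, hτ]
  obtain ⟨y, hy⟩ := h φ
  have hφy : ∀ u, φ u = u y := fun u => by rw [← hy, NormedSpace.dual_def]
  have hbelow : ∀ (x : X) (u : StrongDual ℝ X) (t : ℝ), ‖x‖ ^ 2 + ‖u‖ ^ 2 + 2 * t < 0 → V x + u y + t * τ < s := by
    intro x u t ht
    rw [← hφy, ← hf]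
    exact hD _ ht
  have habove : ∀ p ∈ G, s ≤ V p.1 + p.2 y + p.2 p.1 * τ := by
    intro p hp
    rw [← hφy, ← hf]
    exact hC _ (subset_convexHull _ _ ⟨p, hp, rfl⟩)
  -- The hyperplane is not vertical: below a point of the lifted graph there are points of the
  -- region on the same vertical line.
  have hτ0 : 0 < τ := by
    obtain ⟨p, hp⟩ := hne
    have h1 := habove p hp
    have h2 := hbelow p.1 p.2 (-(‖p.1‖ ^ 2 / 2 + ‖p.2‖ ^ 2 / 2) - 1) (by linarith)
    have h3 := neg_apply_le p.1 p.2
    by_contra! hneg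
    nlinarith
  have hinv : τ⁻¹ * τ = 1 := inv_mul_cancel₀ hτ0.ne'
  refine ⟨τ⁻¹ • V, τ⁻¹ • y, τ⁻¹ * s, fun x u => ?_, fun p hp => ?_⟩
  · have key : V x + u y - (‖x‖ ^ 2 / 2 + ‖u‖ ^ 2 / 2) * τ ≤ s := by
      refine le_of_forall_pos_le_add fun ε hε => ?_
      have h1 := hbelow x u (-(‖x‖ ^ 2 / 2 + ‖u‖ ^ 2 / 2) - ε / τ)
        (by linarith [div_pos hε hτ0])
      have h2 : ε / τ * τ = ε := div_mul_cancel₀ _ hτ0.ne'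
      linarith
    have := mul_le_mul_of_nonneg_left key (inv_nonneg.2 hτ0.le)
    simp only [smul_apply, map_smul, smul_eq_mul]
    linear_combination this + (‖x‖ ^ 2 / 2 + ‖u‖ ^ 2 / 2) * hinv
  · have := mul_le_mul_of_nonneg_left (habove p hp) (inv_nonneg.2 hτ0.le)
    simp only [smul_apply, map_smul, smul_eq_mul]
    linear_combination this + p.2 p.1 * hinv

/-- In a reflexive space, a maximal monotone set `G` contains a point `(y, v)` with `-v ∈ J y`;
that is, `0` is in the range of `J + G`. -/
theorem IsReflexiveSpace.exists_mem_neg_mem_dualityMap (h : IsReflexiveSpace X)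
    {G : Set (X × StrongDual ℝ X)}
    (hG : ∀ p ∈ G, ∀ q ∈ G, 0 ≤ (p.2 - q.2) (p.1 - q.1))
    (hmax : ∀ q : X × StrongDual ℝ X, (∀ p ∈ G, 0 ≤ (p.2 - q.2) (p.1 - q.1)) → q ∈ G) :
    ∃ q ∈ G, -q.2 ∈ dualityMap X q.1 := by
  have hne : G.Nonempty := by
    by_contra hempty
    rw [Set.not_nonempty_iff_eq_empty] at hempty
    simpa [hempty] using hmax 0
  obtain ⟨U, Y, s, hs, hsG⟩ := h.exists_separation hne hG
  -- The left-hand side of `hs` is largest where `U ∈ J x` and `u ∈ J Y`.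
  have hsUY : ‖Y‖ ^ 2 / 2 + ‖U‖ ^ 2 / 2 ≤ s := by
    obtain ⟨x, hx⟩ := h.exists_mem_dualityMap U
    obtain ⟨u, hu⟩ := _root_.exists_mem_dualityMap Y
    have := hs x u
    rw [hx.1, hu.1, hu.2, ← hx.2] at this
    linarith
  have hrel : ∀ p ∈ G, s + U Y ≤ (p.2 - -U) (p.1 - -Y) := by
    intro p hp
    have := hsG p hp
    simp only [sub_neg_eq_add, add_apply, map_add]
    linarith
  have hmem : (-Y, -U) ∈ G := hmax _ fun p hp => by
    linarith [hrel p hp, neg_apply_le Y U]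
  refine ⟨_, hmem, ?_⟩
  have h0 := hrel _ hmem
  simp only [sub_self, map_zero] at h0
  have := neg_mem_dualityMap_neg (neg_mem_dualityMap_of_le (x := Y) (u := U) (by linarith))
  simpa using this

end Monotone

/-! ### Resolvents of `α`-monotone operators -/

section Resolvent

variable {X : Type*} [NormedAddCommGroup X] [NormedSpace ℝ X]

theorem mem_dualityResolvent_smul {A : SetValuedMap X (StrongDual ℝ X)} {γ : ℝ} {x z : X} :
    z ∈ dualityResolvent (γ • A) x ↔
      ∃ j ∈ dualityMap X z, ∃ u ∈ A z, j + γ • u ∈ dualityMap X x := by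
  simp only [dualityResolvent, SetValuedMap.comp, SetValuedMap.inverse, mem_ofPred_eq,
    Pi.add_apply, Pi.smul_apply, Set.mem_add, Set.mem_smul_set]
  constructor
  · rintro ⟨w, hw, j, hj, _, ⟨u, hu, rfl⟩, rfl⟩
    exact ⟨j, hj, u, hu, hw⟩
  · rintro ⟨j, hj, u, hu, hw⟩
    exact ⟨_, hw, j, hj, _, ⟨u, hu, rfl⟩, rfl⟩

/-- If `(x, u)` and `(y, v)` satisfy the `α`-monotonicity inequality and have the same image under
`J + γ A`, then `x = y`: the inequality turns into `(1 + γ α) ⟨x - y, J x - J y⟩ ≤ 0`. -/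
theorem eq_of_add_smul_eq_add_smul [StrictConvexSpace ℝ X] {α γ : ℝ} (hγ : 0 < γ)
    (hαγ : 0 < 1 + γ * α) {x y : X} {u v j k : StrongDual ℝ X}
    (hj : j ∈ dualityMap X x) (hk : k ∈ dualityMap X y)
    (hmon : α * (j - k) (x - y) ≤ (u - v) (x - y)) (heq : j + γ • u = k + γ • v) : x = y := by
  refine eq_of_mem_dualityMap_of_apply_sub_nonpos hj hk ?_
  have h1 : (j - k) (x - y) + γ * (u - v) (x - y) = 0 := by
    have : j - k + γ • (u - v) = 0 := by
      rw [smul_sub, ← sub_eq_zero.2 heq]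
      abel
    simpa using congrArg (fun w : StrongDual ℝ X => w (x - y)) this
  have h2 := mul_le_mul_of_nonneg_left hmon hγ.le
  refine nonpos_of_mul_nonpos_right (a := 1 + γ * α) ?_ hαγ
  linarith

theorem IsAlphaMonotone.isSingleValued_dualityResolvent [StrictConvexSpace ℝ X]
    (hsmooth : IsSmoothSpace X) {α γ : ℝ} {A : SetValuedMap X (StrongDual ℝ X)}
    (hA : IsAlphaMonotone α A) (hγ : 0 < γ) (hαγ : 0 < 1 + γ * α) :
    SetValuedMap.IsSingleValued (dualityResolvent (γ • A)) := by
  intro x z hz z' hz'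
  obtain ⟨j, hj, u, hu, hw⟩ := mem_dualityResolvent_smul.1 hz
  obtain ⟨k, hk, v, hv, hw'⟩ := mem_dualityResolvent_smul.1 hz'
  exact eq_of_add_smul_eq_add_smul hγ hαγ hj hk (hA _ _ _ _ hu hv j hj k hk)
    ((hsmooth.existsUnique_mem_dualityMap x).unique hw hw')

theorem IsAlphaMonotone.isMaximallyAlphaMonotone_of_dom_eq_univ [StrictConvexSpace ℝ X]
    (hsmooth : IsSmoothSpace X) (hrefl : IsReflexiveSpace X) {α γ : ℝ}
    {A : SetValuedMap X (StrongDual ℝ X)} (hA : IsAlphaMonotone α A) (hγ : 0 < γ)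
    (hαγ : 0 < 1 + γ * α) (hdom : SetValuedMap.dom (dualityResolvent (γ • A)) = univ) :
    IsMaximallyAlphaMonotone α A := by
  refine ⟨hA, ?_⟩
  rintro ⟨B, hB, hAB, hBA⟩
  refine hBA ?_
  rintro ⟨y, v⟩ hv
  obtain ⟨k, hk⟩ := exists_mem_dualityMap y
  -- Solve `J z + γ A z ∋ J y + γ v`, whose right-hand side is some `J x`.
  obtain ⟨x, hx⟩ := hrefl.exists_mem_dualityMap (k + γ • v)
  obtain ⟨z, hz⟩ : x ∈ SetValuedMap.dom (dualityResolvent (γ • A)) := hdom ▸ mem_univ x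
  obtain ⟨j, hj, u, hu, hw⟩ := mem_dualityResolvent_smul.1 hz
  have heq : j + γ • u = k + γ • v := (hsmooth.existsUnique_mem_dualityMap x).unique hw hx
  obtain rfl : z = y := eq_of_add_smul_eq_add_smul hγ hαγ hj hk
    (hB _ _ _ _ (hAB hu) hv j hj k hk) heq
  rw [(hsmooth.existsUnique_mem_dualityMap z).unique hj hk, add_right_inj] at heq
  exact smul_right_injective _ hγ.ne' heq ▸ hu

/-- A point that is `α`-monotonically related to a maximally `α`-monotone operator belongs to its
graph. -/
theorem IsMaximallyAlphaMonotone.mem_of_forall_le (hsmooth : IsSmoothSpace X) {α : ℝ}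
    {A : SetValuedMap X (StrongDual ℝ X)} (hA : IsMaximallyAlphaMonotone α A) {y : X}
    {v k : StrongDual ℝ X} (hk : k ∈ dualityMap X y)
    (h : ∀ x, ∀ u ∈ A x, ∀ j ∈ dualityMap X x, α * (j - k) (x - y) ≤ (u - v) (x - y)) :
    v ∈ A y := by
  by_contra hv
  have hflip : ∀ (a b : StrongDual ℝ X) (x x' : X), (a - b) (x - x') = (b - a) (x' - x) := by
    intro a b x x'
    rw [← neg_sub b a, ← neg_sub x' x, map_neg, neg_apply, neg_neg]
  refine hA.2 ⟨fun x => {u | u ∈ A x ∨ (x = y ∧ u = v)}, ?_, ?_, ?_⟩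
  · rintro x u x' u' (hu | ⟨rfl, rfl⟩) (hu' | ⟨rfl, rfl⟩) j hj j' hj'
    · exact hA.1 _ _ _ _ hu hu' j hj j' hj'
    · rw [(hsmooth.existsUnique_mem_dualityMap _).unique hj' hk]
      exact h x u hu j hj
    · rw [(hsmooth.existsUnique_mem_dualityMap _).unique hj hk, hflip k, hflip u]
      exact h x' u' hu' j' hj'
    · simp
  · exact fun p hp => Or.inl hp
  · exact fun hsub => hv (hsub (show (y, v) ∈ _ from Or.inr ⟨rfl, rfl⟩))

theorem IsMaximallyAlphaMonotone.dom_dualityResolvent_eq_univ (hsmooth : IsSmoothSpace X)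
    (hrefl : IsReflexiveSpace X) {α γ : ℝ} {A : SetValuedMap X (StrongDual ℝ X)}
    (hA : IsMaximallyAlphaMonotone α A) (hγ : 0 < γ) (hαγ : 0 < 1 + γ * α) :
    SetValuedMap.dom (dualityResolvent (γ • A)) = univ := by
  refine eq_univ_of_forall fun x => ?_
  obtain ⟨w, hw⟩ := exists_mem_dualityMap x
  -- Here `J + γ A - w = (1 + γ α) (J + G)`, where `G` is maximal monotone.
  set c := 1 + γ * α with hc
  have hcγ : 0 ≤ c⁻¹ * γ := by positivity
  have hdiff : ∀ (u v j k : StrongDual ℝ X) (a : X),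
      (c⁻¹ • (γ • (u - α • j) - w) - c⁻¹ • (γ • (v - α • k) - w)) a
        = c⁻¹ * γ * ((u - v) a - α * (j - k) a) := by
    intro u v j k a
    simp only [sub_apply, smul_apply, smul_eq_mul]
    ring
  obtain ⟨⟨z, _⟩, ⟨u, hu, j, hj, rfl⟩, hzj⟩ := hrefl.exists_mem_neg_mem_dualityMap
    (G := {p | ∃ u ∈ A p.1, ∃ j ∈ dualityMap X p.1, p.2 = c⁻¹ • (γ • (u - α • j) - w)})
    (by
      rintro ⟨x₁, _⟩ ⟨u, hu, j, hj, rfl⟩ ⟨x₂, _⟩ ⟨v, hv, k, hk, rfl⟩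
      rw [hdiff]
      exact mul_nonneg hcγ (sub_nonneg.2 (hA.1 x₁ u x₂ v hu hv j hj k hk)))
    (by
      rintro ⟨y, v⟩ hq
      obtain ⟨k, hk⟩ := exists_mem_dualityMap y
      -- The value `v'` for which `(y, v)` is the image of `(y, v')`.
      obtain ⟨v', rfl⟩ : ∃ v', v = c⁻¹ • (γ • (v' - α • k) - w) := by
        refine ⟨γ⁻¹ • (c • v + w) + α • k, ?_⟩
        rw [add_sub_cancel_right, smul_inv_smul₀ hγ.ne', add_sub_cancel_right,
          inv_smul_smul₀ hαγ.ne']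
      refine ⟨v', hA.mem_of_forall_le hsmooth hk fun x' u hu j hj => ?_, k, hk, rfl⟩
      have := hq (x', _) ⟨u, hu, j, hj, rfl⟩
      simp only [hdiff] at this
      exact sub_nonneg.1 (nonneg_of_mul_nonneg_right this (by positivity)))
  refine ⟨z, mem_dualityResolvent_smul.2 ⟨j, hj, u, hu, ?_⟩⟩
  have hjz := (hsmooth.existsUnique_mem_dualityMap z).unique hj hzj
  have hsum : c • j + (γ • (u - α • j) - w) = 0 := by
    nth_rewrite 1 [hjz]
    rw [smul_neg, smul_inv_smul₀ hαγ.ne', neg_add_cancel]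
  convert hw using 1
  rw [← sub_eq_zero, ← hsum, hc]
  module

end Resolvent

theorem mainTheorem4 {X : Type*} [NormedAddCommGroup X] [NormedSpace ℝ X] [CompleteSpace X]
    [StrictConvexSpace ℝ X] (hsmooth : IsSmoothSpace X) (hrefl : IsReflexiveSpace X)
    (α γ : ℝ) (A : SetValuedMap X (StrongDual ℝ X)) (hA : IsAlphaMonotone α A)
    (hγ : 0 < γ) (hαγ : 0 < 1 + γ * α) :
    SetValuedMap.IsSingleValued (dualityResolvent (γ • A)) ∧
      (SetValuedMap.dom (dualityResolvent (γ • A)) = univ ↔ IsMaximallyAlphaMonotone α A) := by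
  exact ⟨hA.isSingleValued_dualityResolvent hsmooth hγ hαγ,
    fun h => hA.isMaximallyAlphaMonotone_of_dom_eq_univ hsmooth hrefl hγ hαγ h,
    fun h => h.dom_dualityResolvent_eq_univ hsmooth hrefl hγ hαγ⟩
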